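/- A finite distributionally robust Markov game consists of a finite set $\mathcal N$ of agents, a finite state space $\mathcal S$, finite action sets $\mathcal A_i$ with $\mathcal A=\prod_{i\in\mathcal N}\mathcal A_i$, rewards $r_i:\mathcal S\times\mathcal A\to[0,1]$, and a nonempty $(s,a)$-rectangular uncertainty set $\mathcal P=\prod_{(s,a)\in\mathcal S\times\mathcal A}\mathcal P_s^a$ with $\mathcal P_s^a\subseteq\Delta(\mathcal S)$. A joint policy is a product policy $\pi=(\pi_i)_{i\in\mathcal N}$ of stationary policies $\pi_i:\mathcal S\to\Delta(\mathcal A_i)$. For $\gamma\in[0,1)$, a kernel $\mathsf P\in\mathcal P$, an agent $i$ and an initial state $s$ put $$V^{\pi}_{\gamma,\mathsf P,i}(s)=\mathbb E_{\pi,\mathsf P}\Big[\sum_{t\ge 0}\gamma^t r_i(s_t,a_t)\,\Big|\,s_0=s\Big],\qquad g^{\pi}_{\mathsf P,i}(s)=\liminf_{n\to\infty}\mathbb E_{\pi,\mathsf P}\Big[\frac1n\sum_{t=0}^{n-1}r_i(s_t,a_t)\,\Big|\,s_0=s\Big],$$ and define the robust values $V^{\pi}_{\gamma,\mathcal P,i}(s)=\inf_{\mathsf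 P\in\mathcal P}V^{\pi}_{\gamma,\mathsf P,i}(s)$ and $g^{\pi}_{\mathcal P,i}(s)=\inf_{\mathsf P\in\mathcal P}g^{\pi}_{\mathsf P,i}(s)$. For $\epsilon\ge 0$, a joint policy $\pi$ is an $\epsilon$-Nash equilibrium of the $\gamma$-discounted robust game if $V^{(\pi_{-i},\mu_i)}_{\gamma,\mathcal P,i}(s)\le V^{\pi}_{\gamma,\mathcal P,i}(s)+\epsilon$ for all agents $i$, all stationary policies $\mu_i$ of agent $i$ and all states $s$, and an $\epsilon$-Nash equilibrium of the average-reward robust game if the same holds with $g_{\mathcal P,i}$ in place of $V_{\gamma,\mathcal P,i}$; a Nash equilibrium is a $0$-Nash equilibrium. Assume that $\mathcal P$ is compact and convex and that for every deterministic joint policy $\pi$ and every $\mathsf P\in\mathcal P$ the induced Markov chain on $\mathcal S$ is irreducible. Then: (1) Let $\gamma_t\in[0,1)$ with $\gamma_t\to1$, and let $\pi_t$ be a Nash equilibrium of the $\gamma_t$-discounted robust game for every $t$. If $\pi_t\to\pi$, then $\pi$ is a Nash equilibrium of the average-reward robust game. (2) For every $\epsilon>0$ there is a discount factor $\gamma\in[0,1)$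 such that every $\epsilon$-Nash equilibrium of the $\gamma$-discounted robust game is a $C\epsilon$-Nash equilibrium of the average-reward robust game, where $C>0$ is an absolute constant (it depends neither on $\epsilon$ nor on the game). -/

import Mathlib

open Filter Topology

noncomputable section

/-- A finite distributionally robust Markov game with set of agents `ι`, state space `S` and action
sets `A i`. For every state and joint action there is a set of possible next-state distributions,
chosen independently over all pairs of a state and a joint action. -/
structure RobustMarkovGame (ι S : Type*) (A : ι → Type*) [Fintype S] where
  /-- `reward i s a` is the reward of agent `i` in state `s` under the joint action `a`. -/
  reward : ι → S → (∀ i, A i) → ℝ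
  reward_mem : ∀ i s a, reward i s a ∈ Set.Icc (0 : ℝ) 1
  /-- `uncertainty s a` is the set of possible next-state distributions after `a` in `s`. -/
  uncertainty : S → (∀ i, A i) → Set (S → ℝ)
  uncertainty_subset : ∀ s a, uncertainty s a ⊆ stdSimplex ℝ S
  uncertainty_nonempty : ∀ s a, (uncertainty s a).Nonempty

/-- Stationary policies of one agent: `μ s a` is the probability of the action `a` in state `s`. -/
abbrev StationaryPolicy (S B : Type*) [Fintype B] : Type _ := S → stdSimplex ℝ B

/-- Product policies: one stationary policy for each agent, with the product topology. -/
abbrev JointPolicy {ι : Type*} (S : Type*) (A : ι → Type*) [∀ i, Fintype (A i)] : Type _ :=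
  ∀ i, StationaryPolicy S (A i)

namespace JointPolicy

variable {ι S : Type*} {A : ι → Type*} [∀ i, Fintype (A i)]

/-- The probability of the joint action `a` in state `s`: the agents randomize independently. -/
def prob [Fintype ι] (π : JointPolicy S A) (s : S) (a : ∀ i, A i) : ℝ :=
  ∏ i, (π i s : A i → ℝ) (a i)

/-- In every state every agent plays some action with probability one. -/
def IsDeterministic (π : JointPolicy S A) : Prop :=
  ∀ i s, ∃ a : A i, (π i s : A i → ℝ) a = 1

end JointPolicy

namespace RobustMarkovGame

variable {ι S : Type*} {A : ι → Type*}
  [Fintype ι] [DecidableEq ι] [Fintype S] [DecidableEq S] [∀ i, Fintype (A i)]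

/-- The rectangular set of transition kernels; `P s a s'` is the probability of moving to `s'`. -/
def kernels (G : RobustMarkovGame ι S A) : Set (S → (∀ i, A i) → S → ℝ) :=
  {P | ∀ s a, P s a ∈ G.uncertainty s a}

/-- The transition matrix on the states that the joint policy `π` induces from the kernel `P`. -/
def transitionMatrix (P : S → (∀ i, A i) → S → ℝ) (π : JointPolicy S A) : Matrix S S ℝ :=
  Matrix.of fun s s' => ∑ a, π.prob s a * P s a s'

/-- Expected one-step reward of agent `i` in state `s` under the joint policy `π`. -/
def policyReward (G : RobustMarkovGame ι S A) (π : JointPolicy S A) (i : ι) (s : S) : ℝ :=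
  ∑ a, π.prob s a * G.reward i s a

/-- The expectation, under the kernel `P` and the joint policy `π`, of the reward of agent `i` at
time `t` when the initial state is `s`; the law of the state at time `t` is row `s` of the `t`-th
power of the transition matrix. -/
def expectedReward (G : RobustMarkovGame ι S A) (P : S → (∀ i, A i) → S → ℝ)
    (π : JointPolicy S A) (i : ι) (t : ℕ) (s : S) : ℝ :=
  ∑ s', (transitionMatrix P π ^ t) s s' * G.policyReward π i s'

/-- The `γ`-discounted value of agent `i` under the fixed kernel `P`. -/
def discountedValue (G : RobustMarkovGame ι S A) (γ : ℝ) (P : S → (∀ i, A i) → S → ℝ)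
    (π : JointPolicy S A) (i : ι) (s : S) : ℝ :=
  ∑' t : ℕ, γ ^ t * G.expectedReward P π i t s

/-- The average reward of agent `i` under the fixed kernel `P`. -/
def averageReward (G : RobustMarkovGame ι S A) (P : S → (∀ i, A i) → S → ℝ)
    (π : JointPolicy S A) (i : ι) (s : S) : ℝ :=
  liminf (fun n : ℕ => (1 / (n : ℝ)) * ∑ t ∈ Finset.range n, G.expectedReward P π i t s) atTop

/-- The robust `γ`-discounted value: the worst case over the uncertainty set. -/
def robustDiscountedValue (G : RobustMarkovGame ι S A) (γ : ℝ)
    (π : JointPolicy S A) (i : ι) (s : S) : ℝ :=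
  ⨅ P : G.kernels, G.discountedValue γ P π i s

/-- The robust average reward: the worst case over the uncertainty set. -/
def robustAverageReward (G : RobustMarkovGame ι S A)
    (π : JointPolicy S A) (i : ι) (s : S) : ℝ :=
  ⨅ P : G.kernels, G.averageReward P π i s

/-- `ε`-Nash equilibria of the `γ`-discounted robust game: no agent can gain more than `ε` in any
state by switching to another stationary policy. -/
def IsDiscountedEpsNash (G : RobustMarkovGame ι S A) (γ ε : ℝ) (π : JointPolicy S A) : Prop :=
  ∀ (i : ι) (μ : StationaryPolicy S (A i)) (s : S),
    G.robustDiscountedValue γ (Function.update π i μ) i s ≤ G.robustDiscountedValue γ π i s + ε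

/-- Nash equilibria of the `γ`-discounted robust game. -/
def IsDiscountedNash (G : RobustMarkovGame ι S A) (γ : ℝ) (π : JointPolicy S A) : Prop :=
  ∀ (i : ι) (μ : StationaryPolicy S (A i)) (s : S),
    G.robustDiscountedValue γ (Function.update π i μ) i s ≤ G.robustDiscountedValue γ π i s

/-- `ε`-Nash equilibria of the robust game with average reward. -/
def IsAverageEpsNash (G : RobustMarkovGame ι S A) (ε : ℝ) (π : JointPolicy S A) : Prop :=
  ∀ (i : ι) (μ : StationaryPolicy S (A i)) (s : S),
    G.robustAverageReward (Function.update π i μ) i s ≤ G.robustAverageReward π i s + ε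

/-- Nash equilibria of the robust game with average reward. -/
def IsAverageNash (G : RobustMarkovGame ι S A) (π : JointPolicy S A) : Prop :=
  ∀ (i : ι) (μ : StationaryPolicy S (A i)) (s : S),
    G.robustAverageReward (Function.update π i μ) i s ≤ G.robustAverageReward π i s

/-- Every deterministic joint policy and every kernel of the uncertainty set induce an irreducible
Markov chain, and the uncertainty set is compact and convex. -/
structure IsRegular (G : RobustMarkovGame ι S A) : Prop where
  irreducible : ∀ π : JointPolicy S A, π.IsDeterministic → ∀ P ∈ G.kernels,
    (transitionMatrix P π).IsIrreducible
  isCompact : IsCompact G.kernels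
  convex : Convex ℝ G.kernels

end RobustMarkovGame

end

/-!
The argument is the vanishing discount method, made uniform in the policy and the kernel.

A pair `(c, u)` that solves the Poisson equation `r = c + u - T u` of a stochastic matrix `T` up to
an error of norm `d` pins the average reward to within `d` of `c`. The discounted value
`v = r + γ T v` provides such a pair: for `c = (1 - γ) v s` and `u = v - v s` the defect is
`(1 - γ) T u`. Moreover `‖v - T v‖ ≤ 2 ‖r‖` for every `γ`. If `T` is irreducible, then only
constants satisfy `T u = u`, so that `u ↦ (u s, u - T u)` is injective; over a compact set of such
matrices it is bounded below uniformly, which bounds `u` independently of `γ`, of the policy and of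
the kernel. Hence the normalized values `(1 - γ) V` converge uniformly to the average reward as `γ`
tends to `1`, and so do their infima over the kernels. The limit is therefore continuous in the
policy, the Nash inequalities pass to it, and a slack `ε` in the discounted game only costs
`(1 - γ) ε` in the limit.
-/

open Matrix

section Analysis

theorem abs_liminf_sub_le {α : Type*} {l : Filter α} [l.NeBot] {f e : α → ℝ} {c d : ℝ}
    (he : Tendsto e l (𝓝 0)) (h : ∀ᶠ x in l, |f x - c| ≤ d + e x) : |liminf f l - c| ≤ d := by
  have hlower : Tendsto (fun x => c - (d + e x)) l (𝓝 (c - d)) := by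
    simpa using (he.const_add d).const_sub c
  have hupper : Tendsto (fun x => c + (d + e x)) l (𝓝 (c + d)) := by
    simpa using (he.const_add d).const_add c
  have hle : ∀ᶠ x in l, c - (d + e x) ≤ f x := h.mono fun x hx => by linarith [(abs_le.1 hx).1]
  have hge : ∀ᶠ x in l, f x ≤ c + (d + e x) := h.mono fun x hx => by linarith [(abs_le.1 hx).2]
  have hliminf_ge : c - d ≤ liminf f l := hlower.liminf_eq ▸
    liminf_le_liminf hle hlower.isBoundedUnder_ge
      (hupper.isBoundedUnder_le.mono_le hge).isCoboundedUnder_ge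
  have hliminf_le : liminf f l ≤ c + d := hupper.liminf_eq ▸
    liminf_le_liminf hge (hlower.isBoundedUnder_ge.mono_ge hle)
      hupper.isBoundedUnder_le.isCoboundedUnder_ge
  rw [abs_le]
  constructor <;> linarith

theorem abs_ciInf_sub_ciInf_le {X : Type*} [Nonempty X] {f g : X → ℝ} {c : ℝ}
    (hf : BddBelow (Set.range f)) (hg : BddBelow (Set.range g)) (h : ∀ x, |f x - g x| ≤ c) :
    |(⨅ x, f x) - ⨅ x, g x| ≤ c := by
  have hle : (⨅ x, g x) - c ≤ ⨅ x, f x :=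
    le_ciInf fun x => by linarith [ciInf_le hg x, (abs_le.1 (h x)).1]
  have hge : (⨅ x, f x) - c ≤ ⨅ x, g x :=
    le_ciInf fun x => by linarith [ciInf_le hf x, (abs_le.1 (h x)).2]
  rw [abs_le]
  constructor <;> linarith

theorem exists_norm_le_mul_norm_of_injective {X E F : Type*} [TopologicalSpace X] [CompactSpace X]
    [NormedAddCommGroup E] [NormedSpace ℝ E] [ProperSpace E] [NormedAddCommGroup F]
    [NormedSpace ℝ F] {L : X → E →ₗ[ℝ] F} (hL : Continuous fun p : X × E => L p.1 p.2)
    (hinj : ∀ x, Function.Injective (L x)) : ∃ K : ℝ, ∀ x v, ‖v‖ ≤ K * ‖L x v‖ := by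
  obtain ⟨K, hK⟩ : ∃ K : ℝ, ∀ p ∈ (Set.univ : Set X) ×ˢ Metric.sphere (0 : E) 1,
      ‖L p.1 p.2‖⁻¹ ≤ K := by
    refine ((isCompact_univ.prod (isCompact_sphere (0 : E) 1)).bddAbove_image
      (ContinuousOn.inv₀ hL.norm.continuousOn ?_)).imp fun K hK p hp => hK ⟨p, hp, rfl⟩
    rintro ⟨x, v⟩ ⟨-, hv⟩
    exact norm_ne_zero_iff.2 ((map_ne_zero_iff _ (hinj x)).2 (ne_zero_of_mem_unit_sphere ⟨v, hv⟩))
  refine ⟨K, fun x v => ?_⟩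
  rcases eq_or_ne v 0 with rfl | hv
  · simp
  have hLv : 0 < ‖L x v‖ := norm_pos_iff.2 ((map_ne_zero_iff _ (hinj x)).2 hv)
  have hunit : ‖v‖⁻¹ • v ∈ Metric.sphere (0 : E) 1 := by simp [norm_smul, hv]
  have h := hK (x, ‖v‖⁻¹ • v) ⟨Set.mem_univ x, hunit⟩
  rw [map_smul, norm_smul, norm_inv, norm_norm, mul_inv, inv_inv] at h
  exact (div_le_iff₀ hLv).1 h

end Analysis

section StochasticMatrix

theorem isIrreducible_of_pos_of_pos {n R : Type*} [Ring R] [LinearOrder R] {A B : Matrix n n R}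
    (hA : A.IsIrreducible) (hB : ∀ i j, 0 ≤ B i j) (hAB : ∀ i j, 0 < A i j → 0 < B i j) :
    B.IsIrreducible := by
  refine ⟨hB, fun i j => ?_⟩
  have lift_path (k : n) (p : @Quiver.Path n A.toQuiver i k) :
      ∃ q : @Quiver.Path n B.toQuiver i k,
        @Quiver.Path.length n B.toQuiver i k q = @Quiver.Path.length n A.toQuiver i k p := by
    induction p with
    | nil => exact ⟨@Quiver.Path.nil n B.toQuiver i, rfl⟩
    | cons p e ih =>
      obtain ⟨q, hq⟩ := ih
      exact ⟨@Quiver.Path.cons n B.toQuiver i _ _ q ⟨hAB _ _ e.down⟩, congrArg (· + 1) hq⟩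
  obtain ⟨p, hp⟩ := hA.connected i j
  obtain ⟨q, hq⟩ := lift_path j p
  exact ⟨q, hq.symm ▸ hp⟩

variable {S R : Type*} [Fintype S] [DecidableEq S]

theorem pow_mulVec_eq_self [Semiring R] {T : Matrix S S R} {v : S → R} (hv : T *ᵥ v = v) (t : ℕ) :
    (T ^ t) *ᵥ v = v := by
  induction t with
  | zero => rw [pow_zero, one_mulVec]
  | succ t ih => rw [pow_succ, ← mulVec_mulVec, hv, ih]

theorem mulVec_const_of_mem_rowStochastic [Semiring R] [PartialOrder R] [IsOrderedRing R]
    {T : Matrix S S R} (hT : T ∈ rowStochastic R S) (c : R) :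
    T *ᵥ Function.const S c = Function.const S c := by
  ext s
  simp only [mulVec, dotProduct, Function.const_apply, ← Finset.sum_mul,
    sum_row_of_mem_rowStochastic hT, one_mul]

theorem eq_of_mulVec_eq_self [Ring R] [LinearOrder R] [IsStrictOrderedRing R] {T : Matrix S S R}
    (hT : T ∈ rowStochastic R S) (hirr : T.IsIrreducible) {v : S → R} (hv : T *ᵥ v = v)
    (s s' : S) : v s = v s' := by
  have : Nonempty S := ⟨s⟩
  obtain ⟨m, hm⟩ := Finite.exists_min v
  suffices hmin : ∀ j, v j = v m by rw [hmin s, hmin s']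
  intro j
  obtain ⟨t, -, ht⟩ := (isIrreducible_iff_exists_pow_pos hirr.nonneg).1 hirr m j
  have hTt := pow_mem hT t
  have hsum : ∑ k, (T ^ t) m k * (v k - v m) = 0 := by
    simp only [mul_sub, Finset.sum_sub_distrib, ← Finset.sum_mul,
      sum_row_of_mem_rowStochastic hTt, one_mul]
    exact sub_eq_zero.2 (congrFun (pow_mulVec_eq_self hv t) m)
  have hterm := (Finset.sum_eq_zero_iff_of_nonneg fun k _ =>
    mul_nonneg (nonneg_of_mem_rowStochastic hTt) (sub_nonneg.2 (hm k))).1 hsum j (Finset.mem_univ j)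
  exact sub_eq_zero.1 ((mul_eq_zero.1 hterm).resolve_left ht.ne')

variable {T : Matrix S S ℝ}

theorem norm_mulVec_le_of_mem_rowStochastic (hT : T ∈ rowStochastic ℝ S) (u : S → ℝ) :
    ‖T *ᵥ u‖ ≤ ‖u‖ := by
  refine (pi_norm_le_iff_of_nonneg (norm_nonneg u)).2 fun s => ?_
  calc ‖∑ j, T s j * u j‖ ≤ ∑ j, T s j * ‖u‖ := norm_sum_le_of_le _ fun j _ => by
        rw [norm_mul, Real.norm_of_nonneg (nonneg_of_mem_rowStochastic hT)]
        exact mul_le_mul_of_nonneg_left (norm_le_pi_norm u j) (nonneg_of_mem_rowStochastic hT)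
    _ = ‖u‖ := by rw [← Finset.sum_mul, sum_row_of_mem_rowStochastic hT, one_mul]

theorem exists_norm_sub_const_le {X : Type*} [TopologicalSpace X] [CompactSpace X]
    {M : X → Matrix S S ℝ} (hM : Continuous M) (hst : ∀ x, M x ∈ rowStochastic ℝ S)
    (hirr : ∀ x, (M x).IsIrreducible) (s : S) :
    ∃ K : ℝ, ∀ x (v : S → ℝ), ‖v - Function.const S (v s)‖ ≤ K * ‖v - M x *ᵥ v‖ := by
  let L (x : X) : (S → ℝ) →ₗ[ℝ] ℝ × (S → ℝ) :=
    (LinearMap.proj s).prod (LinearMap.id - (M x).mulVecLin)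
  have hL : Continuous fun p : X × (S → ℝ) => L p.1 p.2 :=
    ((continuous_apply s).comp continuous_snd).prodMk
      (continuous_snd.sub ((hM.comp continuous_fst).matrix_mulVec continuous_snd))
  have hinj (x : X) : Function.Injective (L x) := by
    refine (injective_iff_map_eq_zero _).2 fun v hv => funext fun s' => ?_
    obtain ⟨hs, hharm⟩ := Prod.mk.inj hv
    rw [eq_of_mulVec_eq_self (hst x) (hirr x) (sub_eq_zero.1 hharm).symm s' s]
    exact hs
  obtain ⟨K, hK⟩ := exists_norm_le_mul_norm_of_injective hL hinj
  refine ⟨K, fun x v => (hK x _).trans_eq ?_⟩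
  have hLv : L x (v - Function.const S (v s)) = (0, v - M x *ᵥ v) := by
    refine Prod.ext (sub_self (v s)) ?_
    change v - Function.const S (v s) - M x *ᵥ (v - Function.const S (v s)) = v - M x *ᵥ v
    rw [mulVec_sub, mulVec_const_of_mem_rowStochastic (hst x)]
    abel
  rw [hLv, Prod.norm_mk, norm_zero, max_eq_right (norm_nonneg _)]

theorem norm_sum_range_pow_mulVec_sub_le (hT : T ∈ rowStochastic ℝ S) (r u : S → ℝ) (c : ℝ)
    (n : ℕ) :
    ‖∑ t ∈ Finset.range n, (T ^ t) *ᵥ r - n • Function.const S c‖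
      ≤ n * ‖r - Function.const S c - (u - T *ᵥ u)‖ + 2 * ‖u‖ := by
  -- The defect of `(c, u)` in the Poisson equation.
  set w := r - Function.const S c - (u - T *ᵥ u) with hw
  have hr : r = w + Function.const S c + (u - T *ᵥ u) := by rw [hw]; abel
  have htelescope : ∑ t ∈ Finset.range n, (T ^ t) *ᵥ (u - T *ᵥ u) = u - (T ^ n) *ᵥ u := by
    simp only [mulVec_sub, mulVec_mulVec, ← pow_succ]
    rw [Finset.sum_range_sub', pow_zero, one_mulVec]
  have hsum : ∑ t ∈ Finset.range n, (T ^ t) *ᵥ r - n • Function.const S c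
      = ∑ t ∈ Finset.range n, (T ^ t) *ᵥ w + (u - (T ^ n) *ᵥ u) := by
    rw [hr]
    simp only [mulVec_add, Finset.sum_add_distrib, htelescope,
      mulVec_const_of_mem_rowStochastic (pow_mem hT _), Finset.sum_const, Finset.card_range]
    abel
  have hw_sum : ‖∑ t ∈ Finset.range n, (T ^ t) *ᵥ w‖ ≤ n * ‖w‖ := by
    simpa using norm_sum_le_of_le (Finset.range n) fun t _ =>
      norm_mulVec_le_of_mem_rowStochastic (pow_mem hT t) w
  rw [hsum]
  linarith [norm_add_le (∑ t ∈ Finset.range n, (T ^ t) *ᵥ w) (u - (T ^ n) *ᵥ u),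
    norm_sub_le u ((T ^ n) *ᵥ u), norm_mulVec_le_of_mem_rowStochastic (pow_mem hT n) u]

theorem abs_liminf_average_sub_le (hT : T ∈ rowStochastic ℝ S) (r u : S → ℝ) (c : ℝ) (s : S) :
    |liminf (fun n : ℕ => (1 / (n : ℝ)) * ∑ t ∈ Finset.range n, ((T ^ t) *ᵥ r) s) atTop - c|
      ≤ ‖r - Function.const S c - (u - T *ᵥ u)‖ := by
  have hlim : Tendsto (fun n : ℕ => 2 * ‖u‖ * (1 / (n : ℝ))) atTop (𝓝 0) := by
    simpa using tendsto_one_div_atTop_nhds_zero_nat.const_mul (2 * ‖u‖)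
  refine abs_liminf_sub_le hlim ?_
  filter_upwards [eventually_gt_atTop 0] with n hn
  have hn : (0 : ℝ) < n := Nat.cast_pos.2 hn
  have hsum := (norm_le_pi_norm _ s).trans (norm_sum_range_pow_mulVec_sub_le hT r u c n)
  simp only [Pi.sub_apply, Finset.sum_apply, nsmul_eq_mul, Real.norm_eq_abs] at hsum
  calc _ = |∑ t ∈ Finset.range n, ((T ^ t) *ᵥ r) s - n * c| / n := by
        rw [← abs_of_pos hn, ← abs_div, abs_of_pos hn]
        congr 1
        field_simp
    _ ≤ _ := by
        rw [div_le_iff₀ hn]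
        refine hsum.trans_eq ?_
        field_simp

theorem summable_smul_pow_mulVec (hT : T ∈ rowStochastic ℝ S) {γ : ℝ} (hγ : |γ| < 1)
    (r : S → ℝ) : Summable fun t : ℕ => γ ^ t • (T ^ t) *ᵥ r :=
  .of_norm_bounded ((summable_geometric_of_lt_one (abs_nonneg γ) hγ).mul_right ‖r‖) fun t => by
    rw [norm_smul, norm_pow, Real.norm_eq_abs]
    gcongr
    exact norm_mulVec_le_of_mem_rowStochastic (pow_mem hT t) r

theorem eq_add_smul_mulVec_of_hasSum {γ : ℝ} {r v : S → ℝ}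
    (hv : HasSum (fun t : ℕ => γ ^ t • (T ^ t) *ᵥ r) v) : v = r + γ • T *ᵥ v := by
  have htail : HasSum (fun t : ℕ => γ ^ (t + 1) • (T ^ (t + 1)) *ᵥ r) (γ • T *ᵥ v) := by
    convert (hv.map T.mulVecLin (by fun_prop)).const_smul γ using 2 with t
    · simp [pow_succ', smul_smul]
    · rfl
  simpa using hv.unique htail.zero_add

variable {γ : ℝ} {r v : S → ℝ}

theorem norm_sub_mulVec_le_of_eq_add_smul_mulVec (hT : T ∈ rowStochastic ℝ S) (hγ₀ : 0 ≤ γ)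
    (hγ₁ : γ ≤ 1) (hv : v = r + γ • T *ᵥ v) : ‖v - T *ᵥ v‖ ≤ 2 * ‖r‖ := by
  have hTv := norm_mulVec_le_of_mem_rowStochastic hT v
  have hv_norm : (1 - γ) * ‖v‖ ≤ ‖r‖ := by
    have h : ‖v‖ ≤ ‖r‖ + γ * ‖T *ᵥ v‖ := by
      conv_lhs => rw [hv]
      simpa [norm_smul, abs_of_nonneg hγ₀] using norm_add_le r (γ • T *ᵥ v)
    linarith [mul_le_mul_of_nonneg_left hTv hγ₀]
  have hdiff : v - T *ᵥ v = r - (1 - γ) • T *ᵥ v := by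
    nth_rw 1 [hv]
    module
  calc ‖v - T *ᵥ v‖ ≤ ‖r‖ + (1 - γ) * ‖T *ᵥ v‖ := by
        rw [hdiff]
        simpa [norm_smul, abs_of_nonneg (sub_nonneg.2 hγ₁)] using norm_sub_le r ((1 - γ) • T *ᵥ v)
    _ ≤ ‖r‖ + (1 - γ) * ‖v‖ := by
        have := sub_nonneg.2 hγ₁
        gcongr
    _ ≤ 2 * ‖r‖ := by linarith

theorem abs_liminf_average_sub_discounted_le (hT : T ∈ rowStochastic ℝ S) (hγ : γ ≤ 1)
    (hv : v = r + γ • T *ᵥ v) (s : S) :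
    |liminf (fun n : ℕ => (1 / (n : ℝ)) * ∑ t ∈ Finset.range n, ((T ^ t) *ᵥ r) s) atTop
        - (1 - γ) * v s| ≤ (1 - γ) * ‖v - Function.const S (v s)‖ := by
  set u := v - Function.const S (v s) with hu
  have hresidual : r - Function.const S ((1 - γ) * v s) - (u - T *ᵥ u) = (1 - γ) • T *ᵥ u := by
    have hr : r = v - γ • T *ᵥ v := eq_sub_of_add_eq hv.symm
    have hc : Function.const S ((1 - γ) * v s) = (1 - γ) • Function.const S (v s) := rfl
    rw [hr, hc, hu, mulVec_sub, mulVec_const_of_mem_rowStochastic hT]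
    module
  refine (abs_liminf_average_sub_le hT r u _ s).trans ?_
  rw [hresidual, norm_smul, Real.norm_of_nonneg (sub_nonneg.2 hγ)]
  exact mul_le_mul_of_nonneg_left (norm_mulVec_le_of_mem_rowStochastic hT u) (sub_nonneg.2 hγ)

end StochasticMatrix

namespace JointPolicy

variable {ι S : Type*} {A : ι → Type*} [∀ i, Fintype (A i)]

/-- The deterministic joint policy in which agent `i` plays the action `d s i` in state `s`;
irreducibility passes from such policies to all joint policies. -/
def ofActions [∀ i, DecidableEq (A i)] (d : S → ∀ i, A i) : JointPolicy S A :=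
  fun i s => ⟨Pi.single (d s i) 1, single_mem_stdSimplex ℝ (d s i)⟩

theorem isDeterministic_ofActions [∀ i, DecidableEq (A i)] (d : S → ∀ i, A i) :
    (ofActions d).IsDeterministic :=
  fun i s => ⟨d s i, Pi.single_eq_same _ _⟩

variable [Fintype ι]

theorem prob_nonneg (π : JointPolicy S A) (s : S) (a : ∀ i, A i) : 0 ≤ π.prob s a :=
  Finset.prod_nonneg fun i _ => (π i s).2.1 (a i)

theorem sum_prob [DecidableEq ι] (π : JointPolicy S A) (s : S) : ∑ a, π.prob s a = 1 := by
  simp only [prob]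
  rw [← Fintype.piFinset_univ, ← Finset.prod_univ_sum]
  exact Finset.prod_eq_one fun i _ => (π i s).2.2

theorem continuous_prob (s : S) (a : ∀ i, A i) :
    Continuous fun π : JointPolicy S A => π.prob s a :=
  continuous_finsetProd _ fun i _ => (continuous_apply (a i)).comp
    (continuous_subtype_val.comp ((continuous_apply s).comp (continuous_apply i)))

theorem prob_ofActions [∀ i, DecidableEq (A i)] (d : S → ∀ i, A i) (s : S) (a : ∀ i, A i) :
    (ofActions d).prob s a = if a = d s then 1 else 0 := by
  split_ifs with h
  · subst h
    exact Finset.prod_eq_one fun i _ => Pi.single_eq_same _ _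
  · obtain ⟨i, hi⟩ := Function.ne_iff.1 h
    exact Finset.prod_eq_zero (Finset.mem_univ i) (Pi.single_eq_of_ne hi _)

theorem exists_prob_pos (π : JointPolicy S A) (s : S) : ∃ a, 0 < π.prob s a := by
  have h (i : ι) : ∃ b, 0 < (π i s : A i → ℝ) b := by
    by_contra! hle
    have hsum : ∑ b, (π i s : A i → ℝ) b = 1 := (π i s).2.2
    have hsum_le : ∑ b, (π i s : A i → ℝ) b ≤ 0 := Finset.sum_nonpos fun b _ => hle b
    linarith
  choose a ha using h
  exact ⟨a, Finset.prod_pos fun i _ => ha i⟩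

end JointPolicy

namespace RobustMarkovGame

section TransitionMatrix

variable {ι S : Type*} {A : ι → Type*} [Fintype ι] [DecidableEq ι] [∀ i, Fintype (A i)]

theorem continuous_transitionMatrix {X : Type*} [TopologicalSpace X] {π : X → JointPolicy S A}
    {P : X → S → (∀ i, A i) → S → ℝ} (hπ : Continuous π) (hP : Continuous P) :
    Continuous fun x => transitionMatrix (P x) (π x) :=
  continuous_matrix fun s _ => continuous_finsetSum _ fun a _ =>
    ((JointPolicy.continuous_prob s a).comp hπ).mul (by fun_prop)

theorem transitionMatrix_ofActions [∀ i, DecidableEq (A i)] (P : S → (∀ i, A i) → S → ℝ)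
    (d : S → ∀ i, A i) (s s' : S) :
    transitionMatrix P (JointPolicy.ofActions d) s s' = P s (d s) s' := by
  simp [transitionMatrix, JointPolicy.prob_ofActions]

end TransitionMatrix

variable {ι S : Type*} {A : ι → Type*} [Fintype S]

theorem nonempty_kernels (G : RobustMarkovGame ι S A) : Nonempty G.kernels := by
  choose P hP using G.uncertainty_nonempty
  exact ⟨⟨P, hP⟩⟩

theorem mem_stdSimplex_of_mem_kernels {G : RobustMarkovGame ι S A} {P : S → (∀ i, A i) → S → ℝ}
    (hP : P ∈ G.kernels) (s : S) (a : ∀ i, A i) : P s a ∈ stdSimplex ℝ S :=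
  G.uncertainty_subset s a (hP s a)

variable [Fintype ι] [DecidableEq ι] [∀ i, Fintype (A i)]
  {G : RobustMarkovGame ι S A} {P : S → (∀ i, A i) → S → ℝ}

theorem continuous_policyReward (G : RobustMarkovGame ι S A) (i : ι) :
    Continuous fun π : JointPolicy S A => G.policyReward π i :=
  continuous_pi fun s => continuous_finsetSum _ fun a _ =>
    (JointPolicy.continuous_prob s a).mul continuous_const

theorem policyReward_mem_Icc (π : JointPolicy S A) (i : ι) (s : S) :
    G.policyReward π i s ∈ Set.Icc (0 : ℝ) 1 := by
  refine ⟨Finset.sum_nonneg fun a _ => mul_nonneg (π.prob_nonneg s a) (G.reward_mem i s a).1, ?_⟩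
  rw [← π.sum_prob s]
  exact Finset.sum_le_sum fun a _ =>
    mul_le_of_le_one_right (π.prob_nonneg s a) (G.reward_mem i s a).2

theorem norm_policyReward_le_one (π : JointPolicy S A) (i : ι) : ‖G.policyReward π i‖ ≤ 1 :=
  (pi_norm_le_iff_of_nonneg zero_le_one).2 fun s =>
    (Real.norm_of_nonneg (policyReward_mem_Icc π i s).1).trans_le (policyReward_mem_Icc π i s).2

theorem transitionMatrix_nonneg (hP : P ∈ G.kernels) (π : JointPolicy S A) (s k : S) :
    0 ≤ transitionMatrix P π s k :=
  Finset.sum_nonneg fun a _ =>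
    mul_nonneg (π.prob_nonneg s a) ((mem_stdSimplex_of_mem_kernels hP s a).1 k)

/-- Every transition of a deterministic policy that plays only actions in the support of `π` is
also possible under `π`. -/
theorem isIrreducible_transitionMatrix (hP : P ∈ G.kernels)
    (hirr : ∀ π : JointPolicy S A, π.IsDeterministic → (transitionMatrix P π).IsIrreducible)
    (π : JointPolicy S A) : (transitionMatrix P π).IsIrreducible := by
  classical
  choose d hd using π.exists_prob_pos
  refine isIrreducible_of_pos_of_pos (hirr _ (JointPolicy.isDeterministic_ofActions d))
    (transitionMatrix_nonneg hP π) fun s s' hpos => ?_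
  rw [transitionMatrix_ofActions] at hpos
  exact Finset.sum_pos' (fun a _ => mul_nonneg (π.prob_nonneg s a)
    ((mem_stdSimplex_of_mem_kernels hP s a).1 s')) ⟨d s, Finset.mem_univ _, mul_pos (hd s) hpos⟩

variable [DecidableEq S]

theorem transitionMatrix_mem_rowStochastic (hP : P ∈ G.kernels) (π : JointPolicy S A) :
    transitionMatrix P π ∈ rowStochastic ℝ S := by
  refine mem_rowStochastic_iff_sum.2 ⟨transitionMatrix_nonneg hP π, fun s => ?_⟩
  simp only [transitionMatrix, of_apply]
  rw [Finset.sum_comm]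
  simp only [← Finset.mul_sum, (mem_stdSimplex_of_mem_kernels hP s _).2, mul_one]
  exact π.sum_prob s

section Discounted

variable {γ : ℝ}

theorem hasSum_discountedValue (hP : P ∈ G.kernels) (hγ : |γ| < 1) (π : JointPolicy S A) (i : ι) :
    HasSum (fun t : ℕ => γ ^ t • (transitionMatrix P π ^ t) *ᵥ G.policyReward π i)
      (G.discountedValue γ P π i) := by
  have hsum := summable_smul_pow_mulVec (transitionMatrix_mem_rowStochastic hP π) hγ
    (G.policyReward π i)
  exact Pi.hasSum.2 fun s => (Pi.summable.1 hsum s).hasSum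

theorem discountedValue_eq_add_smul_mulVec (hP : P ∈ G.kernels) (hγ : |γ| < 1)
    (π : JointPolicy S A) (i : ι) :
    G.discountedValue γ P π i
      = G.policyReward π i + γ • transitionMatrix P π *ᵥ G.discountedValue γ P π i :=
  eq_add_smul_mulVec_of_hasSum (hasSum_discountedValue hP hγ π i)

theorem discountedValue_nonneg (hP : P ∈ G.kernels) (hγ : 0 ≤ γ) (π : JointPolicy S A) (i : ι)
    (s : S) : 0 ≤ G.discountedValue γ P π i s :=
  tsum_nonneg fun t => mul_nonneg (pow_nonneg hγ t)
    (nonneg_mulVec_of_mem_rowStochastic (pow_mem (transitionMatrix_mem_rowStochastic hP π) t)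
      (fun s' => (policyReward_mem_Icc π i s').1) s)

theorem continuous_discountedValue (G : RobustMarkovGame ι S A) (hγ : |γ| < 1) (i : ι) (s : S) :
    Continuous fun x : JointPolicy S A × G.kernels => G.discountedValue γ x.2 x.1 i s := by
  refine continuous_tsum (fun t => continuous_const.mul ?_)
    (summable_geometric_of_lt_one (abs_nonneg γ) hγ) fun t x => ?_
  · have hM : Continuous fun x : JointPolicy S A × G.kernels => transitionMatrix x.2.1 x.1 :=
      continuous_transitionMatrix continuous_fst (continuous_subtype_val.comp continuous_snd)
    exact (continuous_apply s).comp
      ((hM.pow t).matrix_mulVec ((G.continuous_policyReward i).comp continuous_fst))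
  · have hT := pow_mem (transitionMatrix_mem_rowStochastic x.2.2 x.1) t
    rw [norm_mul, norm_pow, Real.norm_eq_abs]
    refine mul_le_of_le_one_right (by positivity) ?_
    exact (norm_le_pi_norm _ s).trans
      ((norm_mulVec_le_of_mem_rowStochastic hT _).trans (norm_policyReward_le_one x.1 i))

theorem continuous_robustDiscountedValue (hcompact : IsCompact G.kernels) (hγ : |γ| < 1) (i : ι)
    (s : S) : Continuous fun π : JointPolicy S A => G.robustDiscountedValue γ π i s := by
  have : CompactSpace G.kernels := isCompact_iff_compactSpace.1 hcompact
  have h := IsCompact.continuous_sInf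
    (f := fun (π : JointPolicy S A) (P : G.kernels) => G.discountedValue γ P π i s)
    isCompact_univ (G.continuous_discountedValue hγ i s)
  simp only [Set.image_univ] at h
  exact h

theorem isDiscountedNash_iff_isDiscountedEpsNash_zero {π : JointPolicy S A} :
    G.IsDiscountedNash γ π ↔ G.IsDiscountedEpsNash γ 0 π := by
  simp only [IsDiscountedNash, IsDiscountedEpsNash, add_zero]

end Discounted

section VanishingDiscount

variable (hirr : ∀ π : JointPolicy S A, ∀ P ∈ G.kernels, (transitionMatrix P π).IsIrreducible)
  (hcompact : IsCompact G.kernels)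
include hirr hcompact

theorem exists_abs_averageReward_sub_le (i : ι) (s : S) :
    ∃ K : ℝ, ∀ γ ∈ Set.Ico (0 : ℝ) 1, ∀ P ∈ G.kernels, ∀ π : JointPolicy S A,
      |G.averageReward P π i s - (1 - γ) * G.discountedValue γ P π i s| ≤ (1 - γ) * K := by
  have : CompactSpace G.kernels := isCompact_iff_compactSpace.1 hcompact
  obtain ⟨K, hK⟩ := exists_norm_sub_const_le
    (M := fun x : JointPolicy S A × G.kernels => transitionMatrix x.2.1 x.1)
    (continuous_transitionMatrix continuous_fst (continuous_subtype_val.comp continuous_snd))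
    (fun x => transitionMatrix_mem_rowStochastic x.2.2 x.1) (fun x => hirr x.1 x.2 x.2.2) s
  refine ⟨|K| * 2, fun γ ⟨hγ₀, hγ₁⟩ P hP π => ?_⟩
  have hT := transitionMatrix_mem_rowStochastic hP π
  have hv := discountedValue_eq_add_smul_mulVec hP (abs_lt.2 ⟨by linarith, hγ₁⟩) π i
  have hdiff := norm_sub_mulVec_le_of_eq_add_smul_mulVec hT hγ₀ hγ₁.le hv
  refine (abs_liminf_average_sub_discounted_le hT hγ₁.le hv s).trans
    (mul_le_mul_of_nonneg_left ?_ (sub_nonneg.2 hγ₁.le))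
  calc _ ≤ K * ‖_‖ := hK (π, ⟨P, hP⟩) (G.discountedValue γ P π i)
    _ ≤ |K| * 2 := mul_le_mul (le_abs_self K)
      (hdiff.trans (by linarith [norm_policyReward_le_one (G := G) π i])) (norm_nonneg _)
      (abs_nonneg K)

theorem exists_abs_robustAverageReward_sub_le (i : ι) (s : S) :
    ∃ K : ℝ, ∀ γ ∈ Set.Ico (0 : ℝ) 1, ∀ π : JointPolicy S A,
      |G.robustAverageReward π i s - (1 - γ) * G.robustDiscountedValue γ π i s|
        ≤ (1 - γ) * K := by
  obtain ⟨K, hK⟩ := exists_abs_averageReward_sub_le hirr hcompact i s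
  refine ⟨K, fun γ hγ π => ?_⟩
  have := G.nonempty_kernels
  have hγ' : 0 ≤ 1 - γ := sub_nonneg.2 hγ.2.le
  have hclose (P : G.kernels) := hK γ hγ P P.2 π
  have hdiscounted (P : G.kernels) : 0 ≤ (1 - γ) * G.discountedValue γ P π i s :=
    mul_nonneg hγ' (discountedValue_nonneg P.2 hγ.1 π i s)
  rw [robustDiscountedValue, Real.mul_iInf_of_nonneg hγ']
  refine abs_ciInf_sub_ciInf_le ⟨-((1 - γ) * K), ?_⟩ ⟨0, ?_⟩ hclose
  · rintro _ ⟨P, rfl⟩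
    linarith [(abs_le.1 (hclose P)).1, hdiscounted P]
  · rintro _ ⟨P, rfl⟩
    exact hdiscounted P

theorem tendstoUniformly_robustDiscountedValue (i : ι) (s : S) :
    TendstoUniformly
      (fun (γ : ℝ) (π : JointPolicy S A) => (1 - γ) * G.robustDiscountedValue γ π i s)
      (fun π => G.robustAverageReward π i s) (𝓝[<] 1) := by
  obtain ⟨K, hK⟩ := exists_abs_robustAverageReward_sub_le hirr hcompact i s
  have hlim : Tendsto (fun γ : ℝ => (1 - γ) * K) (𝓝[<] 1) (𝓝 0) := by
    have : Continuous fun γ : ℝ => (1 - γ) * K := by fun_prop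
    simpa using (this.tendsto 1).mono_left nhdsWithin_le_nhds
  refine Metric.tendstoUniformly_iff.2 fun ε hε => ?_
  filter_upwards [hlim.eventually_lt_const hε, Ico_mem_nhdsLT zero_lt_one] with γ hγε hγ π
  exact (hK γ hγ π).trans_lt hγε

theorem continuous_robustAverageReward (i : ι) (s : S) :
    Continuous fun π : JointPolicy S A => G.robustAverageReward π i s := by
  refine (tendstoUniformly_robustDiscountedValue hirr hcompact i s).continuous
    (Eventually.frequently ?_)
  filter_upwards [Ico_mem_nhdsLT zero_lt_one] with γ hγ
  exact continuous_const.mul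
    (continuous_robustDiscountedValue hcompact (abs_lt.2 ⟨by linarith [hγ.1], hγ.2⟩) i s)

section Limit

variable {α : Type*} {l : Filter α} {γ : α → ℝ} {π' : α → JointPolicy S A} {π : JointPolicy S A}

theorem tendsto_robustDiscountedValue (hγ : Tendsto γ l (𝓝[<] 1)) (hπ : Tendsto π' l (𝓝 π))
    (i : ι) (s : S) :
    Tendsto (fun t => (1 - γ t) * G.robustDiscountedValue (γ t) (π' t) i s) l
      (𝓝 (G.robustAverageReward π i s)) := by
  have hunif : TendstoUniformly
      (fun t (ρ : JointPolicy S A) => (1 - γ t) * G.robustDiscountedValue (γ t) ρ i s)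
      (fun ρ => G.robustAverageReward ρ i s) l := fun u hu =>
    hγ.eventually (tendstoUniformly_robustDiscountedValue hirr hcompact i s u hu)
  exact hunif.tendsto_comp (continuous_robustAverageReward hirr hcompact i s).continuousAt hπ

theorem isAverageNash_of_tendsto [l.NeBot] {ε : ℝ} (hγ : Tendsto γ l (𝓝[<] 1))
    (hπ : Tendsto π' l (𝓝 π)) (hNash : ∀ᶠ t in l, G.IsDiscountedEpsNash (γ t) ε (π' t)) :
    G.IsAverageNash π := by
  intro i μ s
  obtain ⟨hγ_lim, hγ_lt⟩ := tendsto_nhdsWithin_iff.1 hγ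
  have hupdate : Tendsto (fun t => Function.update (π' t) i μ) l (𝓝 (Function.update π i μ)) :=
    hπ.update i tendsto_const_nhds
  have hslack : Tendsto (fun t => (1 - γ t) * ε) l (𝓝 0) := by
    simpa using (hγ_lim.const_sub 1).mul_const ε
  have hvalue := (tendsto_robustDiscountedValue hirr hcompact hγ hπ i s).add hslack
  rw [add_zero] at hvalue
  refine le_of_tendsto_of_tendsto
    (tendsto_robustDiscountedValue hirr hcompact hγ hupdate i s) hvalue ?_
  filter_upwards [hNash, hγ_lt] with t ht hlt
  rw [← mul_add]
  exact mul_le_mul_of_nonneg_left (ht i μ s) (sub_nonneg.2 (Set.mem_Iio.1 hlt).le)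

end Limit

theorem eventually_isAverageEpsNash (ε : ℝ) {δ : ℝ} (hδ : 0 < δ) :
    ∀ᶠ γ in 𝓝[<] (1 : ℝ), ∀ π : JointPolicy S A,
      G.IsDiscountedEpsNash γ ε π → G.IsAverageEpsNash δ π := by
  have hclose : ∀ᶠ γ in 𝓝[<] (1 : ℝ), ∀ (i : ι) (s : S) (π : JointPolicy S A),
      |G.robustAverageReward π i s - (1 - γ) * G.robustDiscountedValue γ π i s| < δ / 3 :=
    eventually_all.2 fun i => eventually_all.2 fun s => Metric.tendstoUniformly_iff.1
      (tendstoUniformly_robustDiscountedValue hirr hcompact i s) (δ / 3) (by positivity)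
  have hslack : ∀ᶠ γ in 𝓝[<] (1 : ℝ), (1 - γ) * ε < δ / 3 := by
    have : Continuous fun γ : ℝ => (1 - γ) * ε := by fun_prop
    refine ((this.tendsto 1).mono_left nhdsWithin_le_nhds).eventually_lt_const ?_
    simpa using hδ
  filter_upwards [hclose, hslack, self_mem_nhdsWithin] with γ hγ hγε hγ₁ π hπ i μ s
  have hNash := mul_le_mul_of_nonneg_left (hπ i μ s) (sub_nonneg.2 (Set.mem_Iio.1 hγ₁).le)
  linarith [(abs_lt.1 (hγ i s (Function.update π i μ))).2, (abs_lt.1 (hγ i s π)).1]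

end VanishingDiscount

end RobustMarkovGame

theorem mainTheorem3_general {ι S : Type*} {A : ι → Type*}
    [Fintype ι] [DecidableEq ι] [Fintype S] [DecidableEq S] [∀ i, Fintype (A i)]
    (G : RobustMarkovGame ι S A)
    (hirr : ∀ π : JointPolicy S A, π.IsDeterministic → ∀ P ∈ G.kernels,
      (RobustMarkovGame.transitionMatrix P π).IsIrreducible)
    (hcompact : IsCompact G.kernels) (ε : ℝ) :
    (∀ (γ : ℕ → ℝ) (π' : ℕ → JointPolicy S A) (π : JointPolicy S A),
      Tendsto γ atTop (𝓝[<] 1) → Tendsto π' atTop (𝓝 π) →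
      (∀ t, G.IsDiscountedEpsNash (γ t) ε (π' t)) → G.IsAverageNash π) ∧
    (∀ δ : ℝ, 0 < δ → ∀ᶠ γ in 𝓝[<] (1 : ℝ), ∀ π : JointPolicy S A,
      G.IsDiscountedEpsNash γ ε π → G.IsAverageEpsNash δ π) := by
  have hirr' (π : JointPolicy S A) (P) (hP : P ∈ G.kernels) :=
    RobustMarkovGame.isIrreducible_transitionMatrix hP (fun ρ hρ => hirr ρ hρ P hP) π
  exact ⟨fun γ π' π hγ hπ hNash =>
    RobustMarkovGame.isAverageNash_of_tendsto hirr' hcompact hγ hπ (.of_forall hNash),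
    fun δ hδ => RobustMarkovGame.eventually_isAverageEpsNash hirr' hcompact ε hδ⟩

theorem mainTheorem3 :
    ∃ C : ℝ, 0 < C ∧
      ∀ (ι S : Type*) (A : ι → Type*)
        [Fintype ι] [DecidableEq ι] [Fintype S] [DecidableEq S] [∀ i, Fintype (A i)]
        (G : RobustMarkovGame ι S A), G.IsRegular →
        (∀ (γ : ℕ → ℝ) (π' : ℕ → JointPolicy S A) (π : JointPolicy S A),
          (∀ t, 0 ≤ γ t ∧ γ t < 1) → Tendsto γ atTop (𝓝 1) →
          (∀ t, G.IsDiscountedNash (γ t) (π' t)) → Tendsto π' atTop (𝓝 π) →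
          G.IsAverageNash π) ∧
        (∀ ε : ℝ, 0 < ε → ∃ γ : ℝ, 0 ≤ γ ∧ γ < 1 ∧
          ∀ π : JointPolicy S A, G.IsDiscountedEpsNash γ ε π → G.IsAverageEpsNash (C * ε) π) := by
  refine ⟨1, one_pos, fun ι S A _ _ _ _ _ G hG =>
    ⟨fun γ π' π hγ hlim hNash hπ => ?_, fun ε hε => ?_⟩⟩
  · exact (mainTheorem3_general G hG.irreducible hG.isCompact 0).1 γ π' π
      (tendsto_nhdsWithin_iff.2 ⟨hlim, .of_forall fun t => (hγ t).2⟩) hπ fun t =>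
        RobustMarkovGame.isDiscountedNash_iff_isDiscountedEpsNash_zero.1 (hNash t)
  · obtain ⟨γ, hγ, hNash⟩ := ((eventually_mem_set.2 (Ico_mem_nhdsLT zero_lt_one)).and <|
      (mainTheorem3_general G hG.irreducible hG.isCompact ε).2 (1 * ε) (by simpa using hε)).exists
    exact ⟨γ, hγ.1, hγ.2, hNash⟩
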